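/- Let $K$ be a subring of $\mathbb{C}$. For a group $G$ and an additive subgroup $\mathbb{Z}\subseteq\Lambda\subseteq\mathbb{Q}$, say that $G$ \emph{fulfills the Atiyah conjecture of order $\Lambda$ over $KG$} if for all $m,n$ and all $m\times n$ matrices $A$ over $KG$ the kernel of the induced bounded operator $A\colon l^2(G)^n\to l^2(G)^m$ satisfies $$\dim_G(\ker A):=\sum_{i=1}^n\langle \mathrm{pr}_{\ker A}e_i,e_i\rangle\in\Lambda,$$ where $\mathrm{pr}_{\ker A}$ is the orthogonal projection onto $\ker A$ and $e_i\in l^2(G)^n$ has the unit element of $G\subset l^2(G)$ in position $i$ and zeros elsewhere. Let $H$ be a finite group. Then $H$ fulfills the Atiyah conjecture of order $\frac{1}{|H|}\mathbb{Z}$ over $KH$. Moreover, let $G$ be a group, and let $\Delta$ and $\Omega=\Omega'\amalg X$ (a disjoint union of $G$- and $H$-invariant subsets) be sets with commuting left $G$-action and right $H$-action which are free as $H$-sets. Assume that $\Delta$ and $\Omega'$ are free $G$-sets and that $X$ consists of exactly $r$ $H$-orbits, $1\le r<\infty$. Assume that there is a bijective map $\phi\colon\Delta\to\Omega$ such that (i)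 for each $g\in G$ the set $\{x\in\Delta : \phi(gx)\ne g\phi(x)\}$ is contained in a union of finitely many $H$-orbits ($\phi$ is an $H$-almost $G$-map), and (ii) each $H$-orbit of $\Delta$ is mapped by $\phi$ bijectively onto an $H$-orbit of $\Omega$ ($\phi$ is a right $H$-blockwise map). Then $G$ fulfills the Atiyah conjecture of order $\frac{1}{r|H|}\mathbb{Z}$ over $KG$. -/

import Mathlib

noncomputable section

namespace L2Atiyah

/-- The Hilbert space `l²(G)` of square-summable functions `G → ℂ`. -/
abbrev L2 (G : Type*) : Type _ := lp (fun _ : G => ℂ) 2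

/-- The Hilbert space direct sum `l²(G)ⁿ`. -/
abbrev L2Pow (G : Type*) (n : ℕ) : Type _ := PiLp 2 (fun _ : Fin n => L2 G)

theorem memℓp_translate {G : Type*} [Group G] (g : G) (f : L2 G) :
    Memℓp (fun x : G => (f : G → ℂ) (g⁻¹ * x)) 2 := by
  apply memℓp_gen
  exact ((Equiv.mulLeft g⁻¹).summable_iff (f := fun x => ‖(f : G → ℂ) x‖ ^ (2 : ENNReal).toReal)).2
    ((lp.memℓp f).summable (by norm_num))

/-- Left translation by `g` on `l²(G)`: `(g f)(x) = f (g⁻¹ x)`, so that the basis vector at `x`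
is sent to the basis vector at `g x`. -/
def translate {G : Type*} [Group G] (g : G) : L2 G →L[ℂ] L2 G :=
  LinearMap.mkContinuous
    { toFun := fun f => ⟨fun x => (f : G → ℂ) (g⁻¹ * x), memℓp_translate g f⟩
      map_add' := fun _ _ => rfl
      map_smul' := fun _ _ => rfl } 1 (by
    intro f
    rw [one_mul]
    apply le_of_eq
    rw [lp.norm_eq_tsum_rpow (by norm_num), lp.norm_eq_tsum_rpow (by norm_num)]
    congr 1
    exact (Equiv.mulLeft g⁻¹).tsum_eq (fun x => ‖(f : G → ℂ) x‖ ^ (2 : ENNReal).toReal))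

/-- The operator on `l²(G)` given by `a = ∑ a_g g` in the group ring `KG`, namely left
convolution `f ↦ ∑ a_g (g f)`. -/
def groupRingOp {K : Subring ℂ} {G : Type*} [Group G] (a : MonoidAlgebra K G) :
    L2 G →L[ℂ] L2 G :=
  ∑ g ∈ a.coeff.support, (a.coeff g : ℂ) • translate g

/-- The operator `l²(G)ⁿ → l²(G)ᵐ` induced by a matrix `A` over `KG`:
`(A f)_i = ∑ j, A_ij f_j`. -/
def matrixOp {K : Subring ℂ} {G : Type*} [Group G] {m n : ℕ}
    (A : Matrix (Fin m) (Fin n) (MonoidAlgebra K G)) : L2Pow G n →L[ℂ] L2Pow G m :=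
  (PiLp.continuousLinearEquiv 2 ℂ (fun _ : Fin m => L2 G)).symm.toContinuousLinearMap ∘L
    ContinuousLinearMap.pi (fun i => ∑ j, groupRingOp (A i j) ∘L
      PiLp.proj 2 (fun _ : Fin n => L2 G) j)

open Classical in
/-- The vector `e_i ∈ l²(G)ⁿ`: the unit element of `G ⊆ l²(G)` in position `i`, zero elsewhere. -/
def basisVec (G : Type*) [Group G] {n : ℕ} (i : Fin n) : L2Pow G n :=
  PiLp.single 2 i (lp.single 2 (1 : G) (1 : ℂ))

/-- The trace `tr_G T = ∑ i, ⟨T e_i, e_i⟩` of an operator on `l²(G)ⁿ`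
(Mathlib's inner product is linear in the second variable). -/
def traceG {G : Type*} [Group G] {n : ℕ} (T : L2Pow G n →L[ℂ] L2Pow G n) : ℂ :=
  ∑ i : Fin n, inner ℂ (basisVec G i) (T (basisVec G i))

/-- `dim_G V = tr_G (pr_V)`, with `pr_V` the orthogonal projection onto `V ⊆ l²(G)ⁿ`. -/
def dimG {G : Type*} [Group G] {n : ℕ} (V : Submodule ℂ (L2Pow G n))
    [V.HasOrthogonalProjection] : ℂ :=
  traceG V.starProjection

/-- `dim_G (ker A)` for a matrix `A` over `KG`. -/
def dimKer {K : Subring ℂ} {G : Type*} [Group G] {m n : ℕ}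
    (A : Matrix (Fin m) (Fin n) (MonoidAlgebra K G)) : ℂ :=
  haveI : CompleteSpace (matrixOp A).ker := (matrixOp A).completeSpace_ker
  dimG (matrixOp A).ker

/-- The Atiyah conjecture of order `Λ` over `KG`, where `ℤ ⊆ Λ ⊆ ℚ`:
every matrix `A` over `KG` has `dim_G (ker A) ∈ Λ`. -/
def AtiyahConjecture (K : Subring ℂ) (G : Type*) [Group G] (Λ : AddSubgroup ℚ) : Prop :=
  ∀ (m n : ℕ) (A : Matrix (Fin m) (Fin n) (MonoidAlgebra K G)), ∃ q ∈ Λ, dimKer A = (q : ℂ)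

/-- `φ` is an `H`-almost `G`-map (`H` acts from the right): for each `g`, the set of `x` with
`φ (g x) ≠ g (φ x)` is contained in finitely many `H`-orbits. -/
def IsAlmostMap (G H : Type*) [Group G] [Group H] {Δ Ω : Type*} [MulAction G Δ]
    [MulAction Hᵐᵒᵖ Δ] [MulAction G Ω] (φ : Δ → Ω) : Prop :=
  ∀ g : G, ∃ T : Set Δ, T.Finite ∧
    {x : Δ | φ (g • x) ≠ g • φ x} ⊆ ⋃ t ∈ T, MulAction.orbit Hᵐᵒᵖ t

/-- `φ` is a right `H`-blockwise map: each `H`-orbit of `Δ` is mapped bijectively to an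
`H`-orbit of `Ω`. -/
def IsBlockwise (H : Type*) [Group H] {Δ Ω : Type*} [MulAction Hᵐᵒᵖ Δ] [MulAction Hᵐᵒᵖ Ω]
    (φ : Δ → Ω) : Prop :=
  ∀ x : Δ, ∃ y : Ω, Set.BijOn φ (MulAction.orbit Hᵐᵒᵖ x) (MulAction.orbit Hᵐᵒᵖ y)

end L2Atiyah

end

/-!
The second claim compares two realisations of the kernel of `A` on the same Hilbert space `l²(Δ)ⁿ`:
one for the action of `G` on `Δ`, the other for the action on `Ω' ⊕ X`, carried over to `Δ` by
`φ`. Since `H` is finite, each `g` acts in the two ways differently at finitely many points only.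

* The two kernels `V` and `V'` contain `W = V ⊓ V'` with finite codimension
  (`finiteDimensional_kerOn_inf`): a vector of `V` lies in `V'` as soon as the finitely many
  coordinates at which the two equations differ vanish. Hence `pr_V - pr_V'` is a difference of two
  projections of finite rank, and its trace, computed over the standard basis, is an
  integer (`exists_hasSum_localDim_sub`).
* The diagonal entries of these projections are known (`localDim_kerOn_apply`): at a point with
  a free `G`-orbit they add up to `dim_G (ker A)`, because that orbit spans an invariant copy of
  `l²(G)ⁿ`, with invariant orthogonal complement. So the contributions to the trace
  cancel except at the `r |H|` points which `φ` maps to `X`.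
* On the finite `G`-set `X` the diagonal entries add up to the dimension of the kernel of `A`
  on `l²(X)ⁿ`, an integer.

Therefore `r |H| dim_G (ker A)` is an integer (`exists_card_mul_dimKer_eq_intCast`). For a finite
group the diagonal entries of the projection are the same at all points of the group and add up to
the complex dimension of the kernel.
-/

namespace L2Atiyah

/-! ### Basis vectors and traces of projections -/

open Classical in
/-- The basis vector of `l²(Y)ⁿ` given by the point `y ∈ Y` in position `i`. -/
noncomputable def pointVec {Y : Type*} {n : ℕ} (i : Fin n) (y : Y) : L2Pow Y n :=
  PiLp.single 2 i (lp.single 2 y (1 : ℂ))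

theorem inner_pointVec_left {Y : Type*} {n : ℕ} (i : Fin n) (y : Y) (f : L2Pow Y n) :
    inner ℂ (pointVec i y) f = f i y := by
  classical
  rw [PiLp.inner_apply, Finset.sum_eq_single i]
  · rw [pointVec, PiLp.single_apply, if_pos rfl, lp.inner_single_left]
    simp
  · intro j _ hj
    rw [pointVec, PiLp.single_apply, if_neg hj, inner_zero_left]
  · simp

/-- The contribution `∑ i, ⟨pr_V (y in position i), (y in position i)⟩` of the point `y ∈ Y` to the
trace of the orthogonal projection onto `V ⊆ l²(Y)ⁿ`. -/
noncomputable def localDim {Y : Type*} {n : ℕ} (V : Submodule ℂ (L2Pow Y n))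
    [V.HasOrthogonalProjection] (y : Y) : ℂ :=
  ∑ i : Fin n, inner ℂ (pointVec i y) (V.starProjection (pointVec i y))

theorem hasSum_norm_sq {Y : Type*} {n : ℕ} (f : L2Pow Y n) :
    HasSum (fun y => ∑ i, ‖f i y‖ ^ 2) (‖f‖ ^ 2) := by
  rw [PiLp.norm_sq_eq_of_L2]
  refine hasSum_sum fun i _ => ?_
  simpa using lp.hasSum_norm (p := 2) (by norm_num) (f i)

/-- The trace of an orthogonal projection of finite rank is the rank: for an orthonormal basis
`q_k` of `V`, the local dimension at `y` is `∑ k, ∑ i, |q_k(i, y)|²`, and `∑ y` turns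
this into `∑ k, ‖q_k‖²`. -/
theorem hasSum_localDim {Y : Type*} {n : ℕ} (V : Submodule ℂ (L2Pow Y n))
    [FiniteDimensional ℂ V] :
    HasSum (localDim V) (Module.finrank ℂ V : ℂ) := by
  let q := stdOrthonormalBasis ℂ V
  have key : ∀ y, localDim V y =
      ((∑ k, ∑ i, ‖((q k : V) : L2Pow Y n) i y‖ ^ 2 : ℝ) : ℂ) := by
    intro y
    rw [Finset.sum_comm]
    push_cast
    refine Finset.sum_congr rfl fun i _ => ?_
    rw [Submodule.starProjection_apply, q.orthogonalProjectionOnto_apply_eq_sum]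
    push_cast
    rw [inner_sum]
    refine Finset.sum_congr rfl fun k _ => ?_
    rw [inner_smul_right, inner_pointVec_left, ← inner_conj_symm, inner_pointVec_left,
      ← Complex.conj_mul']
  have hsum : HasSum (fun y => ∑ k, ∑ i, ‖((q k : V) : L2Pow Y n) i y‖ ^ 2)
      (Module.finrank ℂ V : ℝ) := by
    convert hasSum_sum fun k (_ : k ∈ Finset.univ) => hasSum_norm_sq ((q k : V) : L2Pow Y n)
    have hq : ∀ k, ‖((q k : V) : L2Pow Y n)‖ = 1 := q.orthonormal.1
    simp [hq]
  have h := Complex.hasSum_ofReal.2 hsum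
  rw [funext key]
  rwa [Complex.ofReal_natCast] at h

/-- Local dimensions are additive along `V = W ⊕ (V ⊓ Wᗮ)`. -/
theorem localDim_eq_add {Y : Type*} {n : ℕ} (V W : Submodule ℂ (L2Pow Y n))
    [V.HasOrthogonalProjection] [W.HasOrthogonalProjection]
    [(V ⊓ Wᗮ).HasOrthogonalProjection] (hWV : W ≤ V) (y : Y) :
    localDim V y = localDim W y + localDim (V ⊓ Wᗮ) y := by
  rw [localDim, localDim, localDim, ← Finset.sum_add_distrib]
  refine Finset.sum_congr rfl fun i _ => ?_
  rw [← inner_add_right]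
  congr 1
  set b := pointVec i y
  have hle : Vᗮ ≤ Wᗮ := Submodule.orthogonal_le hWV
  have h : (V ⊓ Wᗮ).starProjection b = V.starProjection b - W.starProjection b := by
    refine Submodule.eq_starProjection_of_mem_of_inner_eq_zero ⟨?_, ?_⟩ ?_
    · exact V.sub_mem (V.starProjection_apply_mem b) (hWV (W.starProjection_apply_mem b))
    · rw [← sub_sub_sub_cancel_left _ _ b]
      exact Wᗮ.sub_mem (W.sub_starProjection_mem_orthogonal b)
        (hle (V.sub_starProjection_mem_orthogonal b))
    · rintro w ⟨hwV, hwW⟩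
      rw [← sub_add, inner_add_left, V.starProjection_inner_eq_zero b w hwV,
        hwW _ (W.starProjection_apply_mem b), add_zero]
  rw [h, add_sub_cancel]

/-! ### Kernels of group ring matrices on permutation modules -/

variable {K : Subring ℂ} {G : Type*} {m n : ℕ}

/-- The coordinate functional `f ↦ f_i(y)` on `l²(Y)ⁿ`. -/
noncomputable def evalAt {Y : Type*} (i : Fin n) (y : Y) : L2Pow Y n →L[ℂ] ℂ :=
  lp.evalCLM ℂ (fun _ : Y => ℂ) 2 y ∘L PiLp.proj 2 (fun _ : Fin n => L2 Y) i

theorem evalAt_apply {Y : Type*} (i : Fin n) (y : Y) (f : L2Pow Y n) : evalAt i y f = f i y :=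
  rfl

/-- The functional `f ↦ (A f)_i(y)`, where `g ∈ G` acts on `l²(Y)` by `(g f)(y) = f (g⁻¹ y)`. The
action on `Y` is given by a plain function `act`, not assumed to be an action, so that two actions
on one set can be compared. -/
noncomputable def entryAt [Group G] {Y : Type*} (act : G → Y → Y)
    (A : Matrix (Fin m) (Fin n) (MonoidAlgebra K G)) (i : Fin m) (y : Y) : L2Pow Y n →L[ℂ] ℂ :=
  ∑ j, ∑ g ∈ (A i j).coeff.support, ((A i j).coeff g : ℂ) • evalAt j (act g⁻¹ y)

theorem entryAt_apply [Group G] {Y : Type*} (act : G → Y → Y)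
    (A : Matrix (Fin m) (Fin n) (MonoidAlgebra K G)) (i : Fin m) (y : Y) (f : L2Pow Y n) :
    entryAt act A i y f =
      ∑ j, ∑ g ∈ (A i j).coeff.support, ((A i j).coeff g : ℂ) * f j (act g⁻¹ y) := by
  simp [entryAt, evalAt_apply]

/-- The kernel of `A` on `l²(Y)ⁿ`, for `G` acting on `Y` by `act`, described as the set of common
zeros of the coordinates of `A f`. -/
noncomputable def kerOn [Group G] {Y : Type*} (act : G → Y → Y)
    (A : Matrix (Fin m) (Fin n) (MonoidAlgebra K G)) : Submodule ℂ (L2Pow Y n) :=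
  ⨅ (i : Fin m) (y : Y), (entryAt act A i y).ker

theorem mem_kerOn [Group G] {Y : Type*} (act : G → Y → Y)
    (A : Matrix (Fin m) (Fin n) (MonoidAlgebra K G)) (f : L2Pow Y n) :
    f ∈ kerOn act A ↔ ∀ i y, entryAt act A i y f = 0 := by
  simp [kerOn]

theorem isClosed_kerOn [Group G] {Y : Type*} (act : G → Y → Y)
    (A : Matrix (Fin m) (Fin n) (MonoidAlgebra K G)) :
    IsClosed (kerOn act A : Set (L2Pow Y n)) := by
  have : (kerOn act A : Set (L2Pow Y n)) =
      ⋂ (i : Fin m) (y : Y), ((entryAt act A i y).ker : Set (L2Pow Y n)) := by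
    simp [kerOn]
  rw [this]
  exact isClosed_iInter fun i => isClosed_iInter fun y => (entryAt act A i y).isClosed_ker

instance [Group G] {Y : Type*} (act : G → Y → Y)
    (A : Matrix (Fin m) (Fin n) (MonoidAlgebra K G)) : CompleteSpace (kerOn act A) :=
  (isClosed_kerOn act A).completeSpace_coe

theorem matrixOp_apply [Group G] (A : Matrix (Fin m) (Fin n) (MonoidAlgebra K G))
    (f : L2Pow G n) (i : Fin m) (x : G) :
    matrixOp A f i x = entryAt (fun g x => g * x) A i x f := by
  rw [entryAt_apply]
  have hterm : ∀ (a : MonoidAlgebra K G) (u : L2 G), (groupRingOp a u : G → ℂ) x =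
      ∑ g ∈ a.coeff.support, (a.coeff g : ℂ) * (u : G → ℂ) (g⁻¹ * x) := by
    intro a u
    rw [groupRingOp, sum_apply, lp.coeFn_sum, Finset.sum_apply]
    rfl
  have hrow : matrixOp A f i = ∑ j, groupRingOp (A i j) (f j) := by
    simp [matrixOp]
  rw [hrow, lp.coeFn_sum, Finset.sum_apply]
  exact Finset.sum_congr rfl fun j _ => hterm _ _

theorem dimKer_eq_localDim [Group G] (A : Matrix (Fin m) (Fin n) (MonoidAlgebra K G)) :
    dimKer A = localDim (kerOn (fun g x : G => g * x) A) 1 := by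
  have h : (matrixOp A).ker = kerOn (fun g x : G => g * x) A := by
    ext f
    rw [mem_kerOn, LinearMap.mem_ker]
    constructor
    · intro h i y
      rw [← matrixOp_apply]
      have : matrixOp A f = 0 := h
      rw [this]; rfl
    · intro h
      change matrixOp A f = 0
      ext i y
      rw [matrixOp_apply, h]; rfl
  have key : ∀ (V W : Submodule ℂ (L2Pow G n)) [V.HasOrthogonalProjection]
      [W.HasOrthogonalProjection], V = W → dimG V = localDim W 1 := by
    rintro V _ _ _ rfl
    rfl
  exact key _ _ h

/-! ### Equivariant injections -/

theorem memℓp_comp {Y Z : Type*} {ι : Y → Z} (hι : Function.Injective ι) (f : L2 Z) :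
    Memℓp (fun y : Y => (f : Z → ℂ) (ι y)) 2 := by
  apply memℓp_gen
  exact ((lp.memℓp f).summable (by norm_num)).comp_injective hι

theorem memℓp_extend {Y Z : Type*} {ι : Y → Z} (hι : Function.Injective ι) (f : L2 Y) :
    Memℓp (Function.extend ι (f : Y → ℂ) 0) 2 := by
  apply memℓp_gen
  refine (hι.summable_iff ?_).1 ?_
  · intro z hz
    rw [Function.extend_apply' _ _ _ (by simpa using hz)]
    simp
  · convert (lp.memℓp f).summable (p := 2) (by norm_num) using 2 with y
    simp [hι.extend_apply]

/-- Restriction of a vector of `l²(Z)ⁿ` along an injection `ι : Y → Z`. -/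
noncomputable def restrict {Y Z : Type*} {ι : Y → Z} (hι : Function.Injective ι) (f : L2Pow Z n) :
    L2Pow Y n :=
  WithLp.toLp 2 fun i => ⟨_, memℓp_comp hι (f i)⟩

/-- Extension by zero of a vector of `l²(Y)ⁿ` along an injection `ι : Y → Z`. -/
noncomputable def extend {Y Z : Type*} {ι : Y → Z} (hι : Function.Injective ι) (f : L2Pow Y n) :
    L2Pow Z n :=
  WithLp.toLp 2 fun i => ⟨_, memℓp_extend hι (f i)⟩

theorem restrict_apply {Y Z : Type*} {ι : Y → Z} (hι : Function.Injective ι) (f : L2Pow Z n)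
    (i : Fin n) (y : Y) : restrict hι f i y = f i (ι y) := rfl

theorem extend_apply {Y Z : Type*} {ι : Y → Z} (hι : Function.Injective ι) (f : L2Pow Y n)
    (i : Fin n) (y : Y) : extend hι f i (ι y) = f i y :=
  hι.extend_apply _ _ _

theorem extend_apply_of_notMem {Y Z : Type*} {ι : Y → Z} (hι : Function.Injective ι)
    (f : L2Pow Y n) (i : Fin n) {z : Z} (hz : z ∉ Set.range ι) : extend hι f i z = 0 :=
  Function.extend_apply' _ _ _ (by simpa using hz)

/-- Extension by zero is adjoint to restriction. -/
theorem inner_extend_left {Y Z : Type*} {ι : Y → Z} (hι : Function.Injective ι)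
    (f : L2Pow Y n) (v : L2Pow Z n) :
    inner ℂ (extend hι f) v = inner ℂ f (restrict hι v) := by
  rw [PiLp.inner_apply, PiLp.inner_apply]
  refine Finset.sum_congr rfl fun i _ => ?_
  rw [lp.inner_eq_tsum, lp.inner_eq_tsum]
  rw [← hι.tsum_eq]
  · refine tsum_congr fun y => ?_
    rw [extend_apply, restrict_apply]
  · intro z hz
    by_contra hz'
    exact hz (by simp [extend_apply_of_notMem hι f i hz'])

/-- The local dimension of the kernel of `A` at a point depends only on the part of the `G`-set
containing that point: if `ι : Y → Z` is an equivariant injection whose range has an invariant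
complement, the projection onto the kernel over `Z` restricts to the one over `Y`. -/
theorem localDim_kerOn_apply [Group G] {Y Z : Type*} (actY : G → Y → Y) (actZ : G → Z → Z)
    {ι : Y → Z} (hι : Function.Injective ι) (hact : ∀ g y, actZ g (ι y) = ι (actY g y))
    (hcompl : ∀ g z, actZ g z ∈ Set.range ι → z ∈ Set.range ι)
    (A : Matrix (Fin m) (Fin n) (MonoidAlgebra K G)) (y : Y) :
    localDim (kerOn actZ A) (ι y) = localDim (kerOn actY A) y := by
  refine Finset.sum_congr rfl fun i _ => ?_
  set u := (kerOn actY A).starProjection (pointVec i y)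
  have hu : u ∈ kerOn actY A := Submodule.starProjection_apply_mem _ _
  -- `extend hι u` lies in the kernel over `Z`; the difference to the basis vector is orthogonal to
  -- that kernel since restriction maps it to the kernel over `Y`.
  have h : (kerOn actZ A).starProjection (pointVec i (ι y)) = extend hι u := by
    refine Submodule.eq_starProjection_of_mem_of_inner_eq_zero ?_ ?_
    · rw [mem_kerOn] at hu ⊢
      intro k z
      by_cases hz : z ∈ Set.range ι
      · obtain ⟨x, rfl⟩ := hz
        rw [← hu k x]
        simp only [entryAt_apply, hact, extend_apply]
      · rw [entryAt_apply]
        refine Finset.sum_eq_zero fun j _ => Finset.sum_eq_zero fun g _ => ?_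
        rw [extend_apply_of_notMem hι _ _ fun h => hz (hcompl _ _ h), mul_zero]
    · intro v hv
      have hv' : restrict hι v ∈ kerOn actY A := by
        rw [mem_kerOn] at hv ⊢
        intro k x
        rw [← hv k (ι x)]
        simp only [entryAt_apply, hact, restrict_apply]
      have := Submodule.starProjection_inner_eq_zero (K := kerOn actY A) (pointVec i y) _ hv'
      rw [inner_sub_left, inner_pointVec_left] at this ⊢
      rw [inner_extend_left]
      exact this
  rw [h, inner_pointVec_left, inner_pointVec_left, extend_apply]

/-! ### Finite perturbations -/

/-- If two actions differ at finitely many points for each `g`, the common kernel has finite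
codimension in each of the two kernels. -/
theorem finiteDimensional_kerOn_inf [Group G] {Y : Type*} (act act' : G → Y → Y)
    (hact : ∀ g, {y | act g y ≠ act' g y}.Finite)
    (A : Matrix (Fin m) (Fin n) (MonoidAlgebra K G)) :
    FiniteDimensional ℂ
      (kerOn act A ⊓ (kerOn act A ⊓ kerOn act' A)ᗮ : Submodule ℂ (L2Pow Y n)) := by
  -- Off the finite set `S` the equations defining the two kernels coincide.
  set S : Set Y := ⋃ (i : Fin m) (j : Fin n), ⋃ g ∈ (A i j).coeff.support,
    {y | act g⁻¹ y ≠ act' g⁻¹ y}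
  have hS : S.Finite :=
    Set.finite_iUnion fun i => Set.finite_iUnion fun j =>
      (A i j).coeff.support.finite_toSet.biUnion fun g _ => hact g⁻¹
  have : Finite S := hS
  have hagree : ∀ i, ∀ y ∉ S, entryAt act A i y = entryAt act' A i y := by
    intro i y hy
    refine Finset.sum_congr rfl fun j _ => Finset.sum_congr rfl fun g hg => ?_
    have : act g⁻¹ y = act' g⁻¹ y := by
      by_contra h
      exact hy (Set.mem_iUnion₂.2 ⟨i, j, Set.mem_iUnion₂.2 ⟨g, hg, h⟩⟩)
    rw [this]
  let D : L2Pow Y n →ₗ[ℂ] (Fin m × S → ℂ) :=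
    LinearMap.pi fun p => (entryAt act' A p.1 p.2).toLinearMap
  let V : Submodule ℂ (L2Pow Y n) := kerOn act A ⊓ (kerOn act A ⊓ kerOn act' A)ᗮ
  refine FiniteDimensional.of_injective (D ∘ₗ V.subtype) ?_
  rw [injective_iff_map_eq_zero]
  rintro ⟨f, hf, hf'⟩ h
  have hf₂ : f ∈ kerOn act' A := by
    rw [mem_kerOn]
    intro i y
    by_cases hy : y ∈ S
    · exact congrFun h (i, ⟨y, hy⟩)
    · rw [← hagree i y hy]
      exact (mem_kerOn act A f).1 hf i y
  have : f = 0 := inner_self_eq_zero.1 (hf' f ⟨hf, hf₂⟩)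
  exact Subtype.ext this

/-- The trace of the difference of the projections onto two kernels of the same matrix is an integer
if the two actions differ at finitely many points for each `g`. -/
theorem exists_hasSum_localDim_sub [Group G] {Y : Type*} (act act' : G → Y → Y)
    (hact : ∀ g, {y | act g y ≠ act' g y}.Finite)
    (A : Matrix (Fin m) (Fin n) (MonoidAlgebra K G)) :
    ∃ k : ℤ, HasSum (fun y => localDim (kerOn act A) y - localDim (kerOn act' A) y) (k : ℂ) := by
  have h₁ := finiteDimensional_kerOn_inf act act' hact A
  have h₂ := finiteDimensional_kerOn_inf act' act (by simpa only [ne_comm] using hact) A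
  rw [inf_comm (kerOn act' A) (kerOn act A)] at h₂
  set W : Submodule ℂ (L2Pow Y n) := kerOn act A ⊓ kerOn act' A
  have : CompleteSpace W :=
    ((isClosed_kerOn act A).inter (isClosed_kerOn act' A)).completeSpace_coe
  refine ⟨(Module.finrank ℂ ↥(kerOn act A ⊓ Wᗮ) : ℤ) - Module.finrank ℂ ↥(kerOn act' A ⊓ Wᗮ), ?_⟩
  have h := (hasSum_localDim (kerOn act A ⊓ Wᗮ)).sub (hasSum_localDim (kerOn act' A ⊓ Wᗮ))
  have hd : (fun y => localDim (kerOn act A) y - localDim (kerOn act' A) y) = fun y =>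
      localDim (kerOn act A ⊓ Wᗮ) y - localDim (kerOn act' A ⊓ Wᗮ) y := by
    funext y
    rw [localDim_eq_add (kerOn act A) W inf_le_left, localDim_eq_add (kerOn act' A) W inf_le_right]
    ring
  rw [hd]
  exact_mod_cast h

/-! ### Finite groups -/

theorem finiteDimensional_L2Pow {Y : Type*} [Finite Y] : FiniteDimensional ℂ (L2Pow Y n) := by
  refine FiniteDimensional.of_injective
    (LinearMap.pi fun p : Fin n × Y => (evalAt p.1 p.2).toLinearMap) ?_
  intro f g h
  ext i y
  exact congrFun h (i, y)

theorem sum_localDim {Y : Type*} [Fintype Y] (V : Submodule ℂ (L2Pow Y n))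
    [V.HasOrthogonalProjection] :
    ∑ y, localDim V y = Module.finrank ℂ V := by
  have : FiniteDimensional ℂ (L2Pow Y n) := finiteDimensional_L2Pow
  exact (hasSum_fintype _).unique (hasSum_localDim V)

theorem exists_mem_zmultiples {N : ℕ} (hN : N ≠ 0) {d : ℂ} {k : ℤ} (h : (N : ℂ) * d = k) :
    ∃ q ∈ AddSubgroup.zmultiples (1 / (N : ℚ)), d = (q : ℂ) := by
  refine ⟨k • (1 / (N : ℚ)), ⟨k, rfl⟩, ?_⟩
  have : (N : ℂ) ≠ 0 := Nat.cast_ne_zero.2 hN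
  rw [zsmul_eq_mul]
  push_cast
  rw [← h]
  field_simp

theorem atiyahConjecture_of_finite [Group G] [Finite G] :
    AtiyahConjecture K G (AddSubgroup.zmultiples (1 / (Nat.card G : ℚ))) := by
  intro m n A
  have := Fintype.ofFinite G
  have h := sum_localDim (kerOn (fun g x : G => g * x) A)
  -- Right multiplication by `x` is equivariant for the left action and maps `1` to `x`.
  have hx : ∀ x : G, localDim (kerOn (fun g x : G => g * x) A) x = dimKer A := by
    intro x
    rw [dimKer_eq_localDim]
    have := localDim_kerOn_apply (fun g x : G => g * x) (fun g x : G => g * x)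
      (mul_left_injective x) (fun g y => (mul_assoc g y x).symm)
      (fun g z _ => ⟨z * x⁻¹, by simp⟩) A 1
    simpa using this
  simp only [hx, Finset.sum_const, Finset.card_univ, nsmul_eq_mul, ← Nat.card_eq_fintype_card] at h
  exact exists_mem_zmultiples Nat.card_pos.ne' (by exact_mod_cast h)

/-! ### Almost equivariant bijections -/

/-- If a free `G`-set `Δ` is in almost equivariant bijection with the disjoint union of a free
`G`-set and a finite `G`-set `X`, then `|X| dim_G (ker A)` is an integer. -/
theorem exists_card_mul_dimKer_eq_intCast [Group G] {Δ Ω' X : Type*} [MulAction G Δ] [MulAction G Ω']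
    [MulAction G X] [IsCancelSMul G Δ] [IsCancelSMul G Ω'] [Finite X]
    (φ : Δ ≃ Ω' ⊕ X) (hφ : ∀ g : G, {x | φ (g • x) ≠ g • φ x}.Finite)
    (A : Matrix (Fin m) (Fin n) (MonoidAlgebra K G)) :
    ∃ k : ℤ, (Nat.card X : ℂ) * dimKer A = k := by
  have := Fintype.ofFinite X
  let act : G → Δ → Δ := fun g x => g • x
  let act' : G → Δ → Δ := fun g x => φ.symm (g • φ x)
  have hact : ∀ g, {x | act g x ≠ act' g x}.Finite := by
    intro g
    convert hφ g using 4 with x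
    exact φ.eq_symm_apply
  obtain ⟨k, hk⟩ := exists_hasSum_localDim_sub act act' hact A
  have hΔ : ∀ x, localDim (kerOn act A) x = dimKer A := by
    intro x
    rw [dimKer_eq_localDim]
    have := localDim_kerOn_apply (fun g x : G => g * x) act (ι := fun g => g • x)
      (fun g h e => IsCancelSMul.right_cancel g h x e) (fun g y => smul_smul g y x)
      (fun g z ⟨h, hz⟩ => ⟨g⁻¹ * h, by
        change (g⁻¹ * h) • x = z
        rw [mul_smul]
        exact inv_smul_eq_iff.2 hz⟩) A 1
    simpa using this
  have hΩ : ∀ w, localDim (kerOn act' A) (φ.symm (Sum.inl w)) = dimKer A := by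
    intro w
    rw [dimKer_eq_localDim]
    have := localDim_kerOn_apply (fun g x : G => g * x) act'
      (ι := fun g => φ.symm (Sum.inl (g • w)))
      (fun g h e => IsCancelSMul.right_cancel g h w (Sum.inl_injective (φ.symm.injective e)))
      (fun g y => by simp [act', mul_smul])
      (fun g z ⟨h, hz⟩ => ⟨g⁻¹ * h, by
        have hz' : Sum.inl (h • w) = g • φ z := φ.symm.injective hz
        change φ.symm (Sum.inl ((g⁻¹ * h) • w)) = z
        rw [φ.symm_apply_eq, mul_smul, ← Sum.smul_inl, hz', inv_smul_smul]⟩) A 1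
    simpa using this
  have hinj : Function.Injective fun x => φ.symm (Sum.inr x) :=
    φ.symm.injective.comp Sum.inr_injective
  have hX : ∀ x, localDim (kerOn act' A) (φ.symm (Sum.inr x)) =
      localDim (kerOn (fun (g : G) (x : X) => g • x) A) x := by
    intro x
    exact localDim_kerOn_apply (fun (g : G) (x : X) => g • x) act' hinj
      (fun g y => by simp [act'])
      (fun g z ⟨h, hz⟩ => ⟨g⁻¹ • h, by
        have hz' : Sum.inr h = g • φ z := φ.symm.injective hz
        change φ.symm (Sum.inr (g⁻¹ • h)) = z
        rw [φ.symm_apply_eq, ← Sum.smul_inr, hz', inv_smul_smul]⟩) A x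
  -- The summands vanish outside the points mapped to `X`.
  rw [← hinj.hasSum_iff] at hk
  · have h := hk.unique (hasSum_fintype _)
    simp only [Function.comp_def, hΔ, hX, Finset.sum_sub_distrib, sum_localDim] at h
    refine ⟨k + Module.finrank ℂ (kerOn (fun (g : G) (x : X) => g • x) A), ?_⟩
    rw [Finset.sum_const, Finset.card_univ, nsmul_eq_mul, ← Nat.card_eq_fintype_card] at h
    push_cast
    rw [h, sub_add_cancel]
  · intro x hx
    obtain ⟨y, rfl⟩ := φ.symm.surjective x
    cases y with
    | inl w => rw [hΔ, hΩ, sub_self]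
    | inr w => exact absurd ⟨w, rfl⟩ hx

end L2Atiyah

/-- Right `H`-actions are `Hᵐᵒᵖ`-actions; for group actions `IsCancelSMul` says that the action is
free (`g • x = x` only for `g = 1`); `Ω' ⊕ X` is the disjoint union of bisets. -/
theorem mainTheorem9 (K : Subring ℂ)
    {G H : Type*} [Group G] [Group H] [Finite H]
    {Δ Ω' X : Type*}
    [MulAction G Δ] [MulAction Hᵐᵒᵖ Δ] [SMulCommClass G Hᵐᵒᵖ Δ]
    [MulAction G Ω'] [MulAction Hᵐᵒᵖ Ω'] [SMulCommClass G Hᵐᵒᵖ Ω']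
    [MulAction G X] [MulAction Hᵐᵒᵖ X] [SMulCommClass G Hᵐᵒᵖ X]
    (hΔH : IsCancelSMul Hᵐᵒᵖ Δ) (hΩH : IsCancelSMul Hᵐᵒᵖ (Ω' ⊕ X))
    (hΔG : IsCancelSMul G Δ) (hΩG : IsCancelSMul G Ω')
    (r : ℕ) (hr : 1 ≤ r) (hX : Nat.card (MulAction.orbitRel.Quotient Hᵐᵒᵖ X) = r)
    (φ : Δ → Ω' ⊕ X) (hφ : Function.Bijective φ)
    (hφG : L2Atiyah.IsAlmostMap G H φ) (hφH : L2Atiyah.IsBlockwise H φ) :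
    L2Atiyah.AtiyahConjecture K H (AddSubgroup.zmultiples (1 / (Nat.card H : ℚ))) ∧
    L2Atiyah.AtiyahConjecture K G
      (AddSubgroup.zmultiples (1 / ((r : ℚ) * (Nat.card H : ℚ)))) := by
  -- As `H` acts freely, `X` has `r |H|` points.
  have hfree : ∀ x : X, MulAction.stabilizer Hᵐᵒᵖ x = ⊥ := by
    refine fun x => (Subgroup.eq_bot_iff_forall _).2 fun h hx => ?_
    refine IsCancelSMul.eq_one_of_smul (P := Ω' ⊕ X) (x := Sum.inr x) ?_
    rw [Sum.smul_inr, MulAction.mem_stabilizer_iff.1 hx]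
  have hcard : Nat.card X = r * Nat.card H := by
    rw [Nat.card_congr (MulAction.selfEquivOrbitsQuotientProd hfree), Nat.card_prod,
      Nat.card_congr MulOpposite.opEquiv.symm]
    exact congrArg (· * _) hX
  have hpos : Nat.card X ≠ 0 := by
    rw [hcard]
    exact Nat.mul_ne_zero (by omega) Nat.card_pos.ne'
  have : Finite X := Nat.finite_of_card_ne_zero hpos
  refine ⟨L2Atiyah.atiyahConjecture_of_finite, fun m n A => ?_⟩
  have : Finite Hᵐᵒᵖ := Finite.of_equiv H MulOpposite.opEquiv
  -- Orbits of the finite group `H` are finite.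
  have hfin : ∀ g : G, {x | φ (g • x) ≠ g • φ x}.Finite := by
    intro g
    obtain ⟨T, hT, hsub⟩ := hφG g
    exact (hT.biUnion fun t _ => Set.finite_range fun h : Hᵐᵒᵖ => h • t).subset hsub
  obtain ⟨k, hk⟩ := L2Atiyah.exists_card_mul_dimKer_eq_intCast (Equiv.ofBijective φ hφ) hfin A
  have h := L2Atiyah.exists_mem_zmultiples hpos hk
  rwa [hcard, Nat.cast_mul] at h
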